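/- Let $h:\mathbb{R}\to[0,\infty)$ be strictly convex, let $c(x,y)=h(y-x)$, and let $c_X,c_Y:\mathbb{R}\to\mathbb{R}$ be functions with $c(x,y)\le c_X(x)+c_Y(y)$ for all $x,y\in\mathbb{R}$. Definitions. A coupling $\gamma$ of two measures $\mu,\nu$ on $\mathbb{R}$ (a measure on $\mathbb{R}\times\mathbb{R}$ with marginals $\mu$ and $\nu$) is optimal if $\int c\,d\gamma\le\int c\,d\gamma'$ for every coupling $\gamma'$ of $\mu,\nu$. For a Markov kernel $K$ on $\mathbb{R}$ and a measure $\mu$, let $\mu\odot K$ be the measure on $\mathbb{R}\times\mathbb{R}$ with $(\mu\odot K)(A\times B)=\int_A K(x,B)\,d\mu(x)$, and let $\mu K$ be its second marginal. $K$ is an optimal transport kernel on a class $\mathcal{S}$ of measures if, for every probability measure $\mu\in\mathcal{S}$ such that $\int c\,d(\mu\odot K)<\infty$, the measure $\mu\odot K$ is an optimal coupling of $\mu$ and $\mu K$; it is an optimal transport kernel if this holds with $\mathcal{S}$ the class of all measures on $\mathbb{R}$. For a finite signed measure $a$ on $\mathbb{R}$ with Jordan decomposition $a=a^+-a^-$,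 put $\|a\|=a^++a^-$ and $aK=a^+K-a^-K$. The signed measure $a$ has the (finite-length) signature $(z_1,\dots,z_n)$ if there are $-\infty=p_0<p_1<\dots<p_n=\infty$ and mutually singular signed measures $a^1,\dots,a^n$ with $a=\sum_{i=1}^n a^i$, such that each $a^i$ is equal to $a^+$ restricted to $(p_{i-1},p_i]$ or to $-a^-$ restricted to $(p_{i-1},p_i]$, the measures $a^i$ and $a^{i+1}$ have strictly opposite signs, i.e. $a^i(\mathbb{R})\,a^{i+1}(\mathbb{R})<0$, for $1\le i<n$, and $z_i=a((p_{i-1},p_i])$ for every $i$ (for $i=n$ the interval is $(p_{n-1},\infty)$). Theorem. Let $a$ and $b$ be finite signed measures on $\mathbb{R}$ with equal mass, $\|a\|(\mathbb{R})=\|b\|(\mathbb{R})$, equal integral, $a(\mathbb{R})=b(\mathbb{R})$, and finite moments, i.e. $c_X$ is integrable with respect to $\|a\|$ and $c_Y$ is integrable with respect to $\|b\|$. Let $(z_1,\dots,z_n)$ be the signature of $a$ and $(w_1,\dots,w_m)$ the signature of $b$, and suppose $(z_i)\ne(w_i)$. Then there is no optimal transport kernel $K$ with $aK=b$. There is not even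 a Markov kernel $K$ with $aK=b$ that is an optimal transport kernel only on the class of probability measures $\eta$ for which $c_X$ is $\eta$-integrable, $\eta\ll\|a\|$, and $d\eta/d\|a\|$ is bounded. -/

import Mathlib

open MeasureTheory ProbabilityTheory
open scoped ENNReal NNReal

namespace KernelOT

/-- `γ` is a coupling of `μ` and `ν`: its two marginals are `μ` and `ν`. -/
def IsCoupling {X Y : Type*} [MeasurableSpace X] [MeasurableSpace Y]
    (γ : Measure (X × Y)) (μ : Measure X) (ν : Measure Y) : Prop :=
  γ.map Prod.fst = μ ∧ γ.map Prod.snd = ν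

/-- The transport cost `∫ c dγ ∈ [0, ∞]` of a plan `γ`, for a non-negative cost function `c`. -/
noncomputable def transportCost {X Y : Type*} [MeasurableSpace X] [MeasurableSpace Y]
    (c : X → Y → ℝ) (γ : Measure (X × Y)) : ℝ≥0∞ :=
  ∫⁻ p, ENNReal.ofReal (c p.1 p.2) ∂γ

/-- `γ` is an optimal coupling of `μ` and `ν`: a coupling of least cost. -/
def IsOptimalCoupling {X Y : Type*} [MeasurableSpace X] [MeasurableSpace Y]
    (c : X → Y → ℝ) (γ : Measure (X × Y)) (μ : Measure X) (ν : Measure Y) : Prop :=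
  IsCoupling γ μ ν ∧
    ∀ γ' : Measure (X × Y), IsCoupling γ' μ ν → transportCost c γ ≤ transportCost c γ'

/-- The Markov kernel `K` is an optimal transport kernel on the class `S` of measures: for each
probability measure `μ` in `S` for which the plan `μ ⊗ₘ K` (the measure
`A × B ↦ ∫_A K(x, B) dμ(x)`) has finite cost, this plan is an optimal coupling of `μ` and its
image `μK`. -/
def IsOptimalTransportKernelOn {X Y : Type*} [MeasurableSpace X] [MeasurableSpace Y]
    (c : X → Y → ℝ) (S : Set (Measure X)) (K : Kernel X Y) : Prop :=
  ∀ μ : Measure X, μ ∈ S → IsProbabilityMeasure μ → transportCost c (μ ⊗ₘ K) < ∞ →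
    IsOptimalCoupling c (μ ⊗ₘ K) μ (K ∘ₘ μ)

/-- An optimal transport kernel: no restriction on the probability measures it acts on. -/
def IsOptimalTransportKernel {X Y : Type*} [MeasurableSpace X] [MeasurableSpace Y]
    (c : X → Y → ℝ) (K : Kernel X Y) : Prop :=
  IsOptimalTransportKernelOn c Set.univ K

/-- The probability measures with finite `cX`-integral that are absolutely continuous with respect
to `μ` with bounded Radon–Nikodym derivative. -/
def boundedDensityClass {X : Type*} [MeasurableSpace X] (cX : X → ℝ) (μ : Measure X) :
    Set (Measure X) :=
  {η | IsProbabilityMeasure η ∧ Integrable cX η ∧ η ≪ μ ∧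
    ∃ M : ℝ≥0, ∀ᵐ x ∂μ, η.rnDeriv μ x ≤ M}

/-- The image `aK` of a signed measure `a = a⁺ - a⁻` (Jordan decomposition) under a Markov
kernel `K`, that is `aK(B) = ∫ K(x, B) da⁺(x) - ∫ K(x, B) da⁻(x)`. -/
noncomputable def signedImage {X Y : Type*} [MeasurableSpace X] [MeasurableSpace Y]
    (a : SignedMeasure X) (K : Kernel X Y) [IsMarkovKernel K] : SignedMeasure Y :=
  (K ∘ₘ a.toJordanDecomposition.posPart).toSignedMeasure
    - (K ∘ₘ a.toJordanDecomposition.negPart).toSignedMeasure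

/-- The interval `(p, q]` of real numbers, with extended real end points. -/
def realIoc (p q : EReal) : Set ℝ := {x | p < (x : EReal) ∧ (x : EReal) ≤ q}

/-- `a` has the finite-length signature `z = (z₁, …, zₙ)`: there are
`-∞ = p₀ < p₁ < ⋯ < pₙ = ∞` and a decomposition `a = a¹ + ⋯ + aⁿ` into mutually singular pieces,
each `aⁱ` being the restriction of `a⁺` or of `-a⁻` to `(pᵢ₋₁, pᵢ]`, where consecutive pieces have
strictly opposite signs and `zᵢ = a((pᵢ₋₁, pᵢ])`. -/
def HasSignature (a : SignedMeasure ℝ) (z : List ℝ) : Prop :=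
  ∃ (p : Fin (z.length + 1) → EReal) (piece : Fin z.length → SignedMeasure ℝ),
    p 0 = ⊥ ∧ p (Fin.last z.length) = ⊤ ∧ StrictMono p ∧
    a = ∑ i, piece i ∧
    (∀ i j, i ≠ j → (piece i).totalVariation ⟂ₘ (piece j).totalVariation) ∧
    (∀ i,
      piece i = (a.toJordanDecomposition.posPart.restrict
        (realIoc (p i.castSucc) (p i.succ))).toSignedMeasure ∨
      piece i = -(a.toJordanDecomposition.negPart.restrict
        (realIoc (p i.castSucc) (p i.succ))).toSignedMeasure) ∧
    (∀ i j : Fin z.length, (j : ℕ) = i + 1 →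
      piece i Set.univ * piece j Set.univ < 0) ∧
    ∀ i, z.get i = a (realIoc (p i.castSucc) (p i.succ))

end KernelOT

/-!
Since `‖a‖` and `‖b‖` have the same total mass, a kernel `K` with `aK = b` cancels nothing: it maps
`a⁺` to `b⁺` and `a⁻` to `b⁻` (`image_parts_of_signedImage_eq`). Hence it maps `‖a‖` to `‖b‖`, the
moment conditions make the plan `‖a‖ ⊗ₘ K` of finite cost, and the normalization of `‖a‖` lies in
the bounded density class. So this plan, normalized, is an optimal coupling.

An optimal plan of finite cost cannot charge two rectangles `A` and `B` such that exchanging the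
targets of any `p ∈ A` and `q ∈ B` strictly decreases the cost: exchanging them along the product
of the two restrictions would improve the plan (`IsOptimalCoupling.measure_eq_zero_of_crossing`).
For a strictly convex `h`, rectangles `I × J` and `I' × J'` with `I` to the left of `I'` and `J`
to the right of `J'` are of this kind (`crossing_lt`).

Let `Iᵢ` and `Jⱼ` be the intervals of the two signatures, and relate `i` to `j` if the plan charges
`Iᵢ × Jⱼ`. This relation is total on both sides, preserves order, and preserves signs. As signs
alternate along both signatures, it can only be the identity (`index_le_of_alternating`, applied in
both directions). So the signatures have the same length, the `i`-th piece of `a` goes entirely to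
the `i`-th piece of `b`, and `zᵢ = wᵢ`.
-/

open Set

namespace KernelOT

/-! ### Order-preserving relations between alternating sequences -/

/-- If consecutive indices on the left have different signs, then moving one step to the right on
the left side forces a move of at least one step on the right side. -/
theorem index_le_of_alternating {n m : ℕ} {R : Fin n → Fin m → Prop} {s : Fin n → Prop}
    {t : Fin m → Prop} (left_total : ∀ i, ∃ j, R i j)
    (mono : ∀ i i' j j', i < i' → R i j → R i' j' → j ≤ j')
    (sign : ∀ i j, R i j → (s i ↔ t j))
    (alternate : ∀ i i' : Fin n, (i' : ℕ) = i + 1 → ¬ (s i ↔ s i')) :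
    ∀ i j, R i j → (i : ℕ) ≤ j := by
  rintro ⟨i, hi⟩
  induction i with
  | zero => intro j _; simp
  | succ i ih =>
    intro j hij
    obtain ⟨k, hk⟩ := left_total ⟨i, by omega⟩
    have h1 := ih (by omega) k hk
    have h2 : k ≤ j := mono _ _ _ _ (by simp) hk hij
    have h3 : k ≠ j := by
      rintro rfl
      exact alternate ⟨i, by omega⟩ ⟨i + 1, hi⟩ rfl ((sign _ _ hk).trans (sign _ _ hij).symm)
    have h4 : (k : ℕ) < j := lt_of_le_of_ne (Fin.le_def.1 h2) (fun h => h3 (Fin.ext h))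
    simp only at h1 ⊢
    omega

/-! ### Optimal plans do not charge crossing rectangles -/

theorem StrictConvexOn.crossing_lt {h : ℝ → ℝ} (hh : StrictConvexOn ℝ univ h)
    {x x' y y' : ℝ} (hx : x < x') (hy : y' < y) :
    h (y' - x) + h (y - x') < h (y - x) + h (y' - x') := by
  have hd : 0 < (x' - x) + (y - y') := by linarith
  have e : (x' - x) / ((x' - x) + (y - y')) + (y - y') / ((x' - x) + (y - y')) = 1 := by
    field_simp
  have h1 := hh.2 (mem_univ (y - x)) (mem_univ (y' - x')) (by linarith)
    (div_pos (sub_pos.2 hx) hd) (div_pos (sub_pos.2 hy) hd) e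
  have h2 := hh.2 (mem_univ (y - x)) (mem_univ (y' - x')) (by linarith)
    (div_pos (sub_pos.2 hy) hd) (div_pos (sub_pos.2 hx) hd) (by rw [add_comm, e])
  simp only [smul_eq_mul] at h1 h2
  have e1 : (x' - x) / ((x' - x) + (y - y')) * (y - x)
      + (y - y') / ((x' - x) + (y - y')) * (y' - x') = y' - x := by
    field_simp; ring
  have e2 : (y - y') / ((x' - x) + (y - y')) * (y - x)
      + (x' - x) / ((x' - x) + (y - y')) * (y' - x') = y - x' := by
    field_simp; ring
  rw [e1] at h1
  rw [e2] at h2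
  linear_combination h1 + h2 + (h (y - x) + h (y' - x')) * e

theorem transportCost_add {X Y : Type*} [MeasurableSpace X] [MeasurableSpace Y]
    (c : X → Y → ℝ) (γ γ' : Measure (X × Y)) :
    transportCost c (γ + γ') = transportCost c γ + transportCost c γ' :=
  lintegral_add_measure _ _ _

theorem transportCost_map {X Y Z : Type*} [MeasurableSpace X] [MeasurableSpace Y]
    [MeasurableSpace Z] {c : X → Y → ℝ} (hc : Measurable fun p : X × Y => c p.1 p.2)
    {f : Z → X × Y} (hf : Measurable f) (π : Measure Z) :
    transportCost c (π.map f) = ∫⁻ q, ENNReal.ofReal (c (f q).1 (f q).2) ∂π :=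
  lintegral_map hc.ennreal_ofReal hf

/-- An optimal plan of finite cost does not charge two disjoint sets `A` and `B` such that
exchanging the targets of points of `A` and `B` always strictly decreases the cost. -/
theorem IsOptimalCoupling.measure_eq_zero_of_crossing {X Y : Type*} [MeasurableSpace X]
    [MeasurableSpace Y] {c : X → Y → ℝ} (hc : Measurable fun p : X × Y => c p.1 p.2)
    (hc0 : ∀ x y, 0 ≤ c x y) {γ : Measure (X × Y)} [IsProbabilityMeasure γ]
    {μ : Measure X} {ν : Measure Y} (hγ : IsOptimalCoupling c γ μ ν)
    (hfin : transportCost c γ < ∞) {A B : Set (X × Y)} (hA : MeasurableSet A)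
    (hB : MeasurableSet B) (hAB : Disjoint A B)
    (hcross : ∀ p ∈ A, ∀ q ∈ B, c p.1 q.2 + c q.1 p.2 < c p.1 p.2 + c q.1 q.2) :
    γ A = 0 ∨ γ B = 0 := by
  by_contra! hne
  -- `γ` is the sum of `ρ` and the marginals of `π = γ|_A × γ|_B` on its two factors, of weight
  -- `γ B` on `A` and `γ A` on `B`. Both weights are at most `1`, so that `ρ` is a measure. The
  -- competitor keeps `ρ` and exchanges the targets of the pairs of points drawn from `π`.
  set α := γ.restrict A with hα
  set β := γ.restrict B with hβ
  set π := α.prod β with hπ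
  set ρ := γ.restrict (A ∪ B)ᶜ + ((1 - γ B) • α + (1 - γ A) • β) with hρ
  have hγ_eq : γ = ρ + (π.map Prod.fst + π.map Prod.snd) := by
    have h1 : α = (1 - γ B) • α + γ B • α := by
      rw [← add_smul, tsub_add_cancel_of_le prob_le_one, one_smul]
    have h2 : β = (1 - γ A) • β + γ A • β := by
      rw [← add_smul, tsub_add_cancel_of_le prob_le_one, one_smul]
    have h3 : γ = γ.restrict (A ∪ B)ᶜ + (α + β) := by
      rw [hα, hβ, ← Measure.restrict_union hAB hB, Measure.restrict_compl_add_restrict (hA.union hB)]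
    rw [hπ, Measure.map_fst_prod, Measure.map_snd_prod, hα, hβ, Measure.restrict_apply_univ,
      Measure.restrict_apply_univ, ← hα, ← hβ, hρ]
    calc γ = γ.restrict (A ∪ B)ᶜ + (α + β) := h3
      _ = γ.restrict (A ∪ B)ᶜ + (((1 - γ B) • α + γ B • α) + ((1 - γ A) • β + γ A • β)) := by
        rw [← h1, ← h2]
      _ = _ := by abel
  let f : (X × Y) × (X × Y) → X × Y := fun q => (q.1.1, q.2.2)
  let g : (X × Y) × (X × Y) → X × Y := fun q => (q.2.1, q.1.2)
  have hf : Measurable f := by fun_prop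
  have hg : Measurable g := by fun_prop
  have hopt := hγ.2 (ρ + (π.map f + π.map g)) (by
    have hm := hγ.1
    rw [hγ_eq] at hm
    constructor
    · rw [← hm.1]
      simp only [Measure.map_add _ _ measurable_fst, Measure.map_map measurable_fst hf,
        Measure.map_map measurable_fst hg, Measure.map_map measurable_fst measurable_fst,
        Measure.map_map measurable_fst measurable_snd]
      rfl
    · rw [← hm.2]
      simp only [Measure.map_add _ _ measurable_snd, Measure.map_map measurable_snd hf,
        Measure.map_map measurable_snd hg, Measure.map_map measurable_snd measurable_fst,
        Measure.map_map measurable_snd measurable_snd]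
      rw [add_comm (Measure.map (Prod.snd ∘ f) π)]
      rfl)
  rw [hγ_eq] at hopt hfin
  simp only [transportCost_add, transportCost_map hc hf, transportCost_map hc hg,
    transportCost_map hc measurable_fst, transportCost_map hc measurable_snd] at hopt hfin
  rw [← lintegral_add_left (by fun_prop), ← lintegral_add_left (by fun_prop)] at hopt
  rw [← lintegral_add_left (by fun_prop)] at hfin
  have hρfin : transportCost c ρ ≠ ∞ := (lt_of_le_of_lt le_self_add hfin).ne
  have hle := (ENNReal.add_le_add_iff_left hρfin).1 hopt
  have hlt : ∀ᵐ q ∂π, ENNReal.ofReal (c (f q).1 (f q).2) + ENNReal.ofReal (c (g q).1 (g q).2)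
      < ENNReal.ofReal (c q.1.1 q.1.2) + ENNReal.ofReal (c q.2.1 q.2.2) := by
    rw [hπ, hα, hβ, Measure.prod_restrict]
    refine (ae_restrict_mem (hA.prod hB)).mono fun q hq => ?_
    have hlt := hcross q.1 hq.1 q.2 hq.2
    rw [← ENNReal.ofReal_add (hc0 _ _) (hc0 _ _), ← ENNReal.ofReal_add (hc0 _ _) (hc0 _ _)]
    exact (ENNReal.ofReal_lt_ofReal_iff_of_nonneg (add_nonneg (hc0 _ _) (hc0 _ _))).2 hlt
  refine absurd hle (not_le.2 (lintegral_strict_mono ?_ ?_ ?_ hlt))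
  · intro h0
    have : π univ = 0 := by simp [h0]
    rw [hπ, ← univ_prod_univ, Measure.prod_prod, hα, hβ, Measure.restrict_apply_univ,
      Measure.restrict_apply_univ, mul_eq_zero] at this
    tauto
  · fun_prop
  · exact ne_top_of_le_ne_top (lt_of_le_of_lt le_add_self hfin).ne
      (lintegral_mono_ae (hlt.mono fun _ => le_of_lt))

/-! ### Kernels that preserve the mass of a signed measure -/

/-- The Jordan decomposition is minimal, so `b⁺ ≤ a⁺K` and `b⁻ ≤ a⁻K`; equality of total masses
turns both inequalities into equalities. -/
theorem image_parts_of_signedImage_eq {X Y : Type*} [MeasurableSpace X] [MeasurableSpace Y]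
    {a : SignedMeasure X} {b : SignedMeasure Y} {K : Kernel X Y} [IsMarkovKernel K]
    (hK : signedImage a K = b) (h_mass : a.totalVariation univ = b.totalVariation univ) :
    K ∘ₘ a.toJordanDecomposition.posPart = b.toJordanDecomposition.posPart ∧
      K ∘ₘ a.toJordanDecomposition.negPart = b.toJordanDecomposition.negPart := by
  have hb : b.toJordanDecomposition = Measure.jordanDecompositionOfToSignedMeasureSub
      (K ∘ₘ a.toJordanDecomposition.posPart) (K ∘ₘ a.toJordanDecomposition.negPart) := by
    rw [← hK, signedImage, Measure.toJordanDecomposition_toSignedMeasure_sub]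
  have hp : b.toJordanDecomposition.posPart ≤ K ∘ₘ a.toJordanDecomposition.posPart := by
    rw [hb]; exact Measure.sub_le
  have hn : b.toJordanDecomposition.negPart ≤ K ∘ₘ a.toJordanDecomposition.negPart := by
    rw [hb]; exact Measure.sub_le
  have hpu := hp univ
  have hnu := hn univ
  have hsum : (K ∘ₘ a.toJordanDecomposition.posPart) univ
      + (K ∘ₘ a.toJordanDecomposition.negPart) univ
      = b.toJordanDecomposition.posPart univ + b.toJordanDecomposition.negPart univ := by
    simpa [SignedMeasure.totalVariation] using h_mass
  have hpe : (K ∘ₘ a.toJordanDecomposition.posPart) univ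
      ≤ b.toJordanDecomposition.posPart univ := by
    refine (ENNReal.add_le_add_iff_right (measure_ne_top (K ∘ₘ a.toJordanDecomposition.negPart)
      univ)).1 ?_
    rw [hsum]; gcongr
  have hne : (K ∘ₘ a.toJordanDecomposition.negPart) univ
      ≤ b.toJordanDecomposition.negPart univ := by
    refine (ENNReal.add_le_add_iff_left (measure_ne_top (K ∘ₘ a.toJordanDecomposition.posPart)
      univ)).1 ?_
    rw [hsum]; gcongr
  exact ⟨(Measure.eq_of_le_of_measure_univ_eq hp (le_antisymm hpu hpe)).symm,
    (Measure.eq_of_le_of_measure_univ_eq hn (le_antisymm hnu hne)).symm⟩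

theorem compProd_prod_le_left {X Y : Type*} [MeasurableSpace X] [MeasurableSpace Y]
    (μ : Measure X) [SFinite μ] (K : Kernel X Y) [IsMarkovKernel K] {s : Set X} (t : Set Y)
    (hs : MeasurableSet s) : (μ ⊗ₘ K) (s ×ˢ t) ≤ μ s := by
  conv_rhs => rw [← Measure.fst_compProd μ K, Measure.fst_apply hs]
  exact measure_mono fun q hq => hq.1

theorem compProd_prod_le_right {X Y : Type*} [MeasurableSpace X] [MeasurableSpace Y]
    (μ : Measure X) [SFinite μ] (K : Kernel X Y) [IsMarkovKernel K] (s : Set X) {t : Set Y}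
    (ht : MeasurableSet t) : (μ ⊗ₘ K) (s ×ˢ t) ≤ (K ∘ₘ μ) t := by
  rw [← Measure.snd_compProd μ K, Measure.snd_apply ht]
  exact measure_mono fun q hq => hq.2

theorem transportCost_compProd_lt_top {X Y : Type*} [MeasurableSpace X] [MeasurableSpace Y]
    {c : X → Y → ℝ} {cX : X → ℝ} {cY : Y → ℝ} (h_bound : ∀ x y, c x y ≤ cX x + cY y)
    {μ : Measure X} [SFinite μ] {K : Kernel X Y} [IsMarkovKernel K] (hX : Integrable cX μ)
    (hY : Integrable cY (K ∘ₘ μ)) : transportCost c (μ ⊗ₘ K) < ∞ := by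
  have h1 : Integrable (fun q : X × Y => cX q.1) (μ ⊗ₘ K) := by
    rw [← Measure.fst_compProd μ K] at hX
    exact hX.comp_measurable measurable_fst
  have h2 : Integrable (fun q : X × Y => cY q.2) (μ ⊗ₘ K) := by
    rw [← Measure.snd_compProd μ K] at hY
    exact hY.comp_measurable measurable_snd
  refine lt_of_le_of_lt (lintegral_mono fun q => ?_) (h1.add h2).2
  exact (ENNReal.ofReal_le_ofReal (h_bound _ _)).trans (Real.ofReal_le_enorm _)

/-- The normalization of `μ` has constant density with respect to `μ`. -/
theorem inv_smul_mem_boundedDensityClass {X : Type*} [MeasurableSpace X] {cX : X → ℝ}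
    {μ : Measure X} [IsFiniteMeasure μ] (h0 : μ univ ≠ 0) (hX : Integrable cX μ) :
    (μ univ)⁻¹ • μ ∈ boundedDensityClass cX μ := by
  have htop : (μ univ)⁻¹ ≠ ∞ := ENNReal.inv_ne_top.2 h0
  refine ⟨⟨by simp [ENNReal.inv_mul_cancel h0 (measure_ne_top _ _)]⟩, hX.smul_measure htop,
    Measure.smul_absolutelyContinuous, ((μ univ)⁻¹).toNNReal, ?_⟩
  filter_upwards [Measure.rnDeriv_smul_left_of_ne_top μ μ htop, Measure.rnDeriv_self μ] with x h1 h2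
  rw [h1, Pi.smul_apply, h2, ENNReal.coe_toNNReal htop]
  simp

/-! ### The intervals of a signature -/

theorem measurableSet_realIoc (p q : EReal) : MeasurableSet (realIoc p q) :=
  measurable_coe_real_ereal measurableSet_Ioc

theorem realIoc_lt {n : ℕ} {p : Fin (n + 1) → EReal} (hp : StrictMono p) {i j : Fin n}
    (hij : i < j) {x y : ℝ} (hx : x ∈ realIoc (p i.castSucc) (p i.succ))
    (hy : y ∈ realIoc (p j.castSucc) (p j.succ)) : x < y := by
  have h : p i.succ ≤ p j.castSucc := hp.monotone (by simpa [Fin.le_def] using hij)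
  exact EReal.coe_lt_coe_iff.1 ((hx.2.trans h).trans_lt hy.1)

theorem disjoint_realIoc {n : ℕ} {p : Fin (n + 1) → EReal} (hp : StrictMono p) {i j : Fin n}
    (hij : i ≠ j) :
    Disjoint (realIoc (p i.castSucc) (p i.succ)) (realIoc (p j.castSucc) (p j.succ)) := by
  rw [Set.disjoint_left]
  intro x hx hy
  rcases lt_or_gt_of_ne hij with h | h
  · exact lt_irrefl _ (realIoc_lt hp h hx hy)
  · exact lt_irrefl _ (realIoc_lt hp h hy hx)

theorem iUnion_realIoc {n : ℕ} {p : Fin (n + 1) → EReal} (h0 : p 0 = ⊥)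
    (hlast : p (Fin.last n) = ⊤) :
    ⋃ i : Fin n, realIoc (p i.castSucc) (p i.succ) = univ := by
  refine eq_univ_of_forall fun x => ?_
  by_contra hx
  simp only [mem_iUnion, realIoc, mem_ofPred_eq, not_exists, not_and, not_le] at hx
  have key : ∀ i : Fin (n + 1), p i < x := by
    intro i
    induction i using Fin.induction with
    | zero => rw [h0]; exact EReal.bot_lt_coe x
    | succ i ih => exact hx i ih
  have := key (Fin.last n)
  rw [hlast] at this
  exact not_top_lt this

/-- For a nonzero signed measure, every entry of a signature is nonzero, and its sign tells which
part of the Jordan decomposition the corresponding interval carries. -/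
theorem HasSignature.exists_intervals {a : SignedMeasure ℝ} {z : List ℝ} (hz : HasSignature a z)
    (ha : a.totalVariation univ ≠ 0) :
    ∃ p : Fin (z.length + 1) → EReal, p 0 = ⊥ ∧ p (Fin.last z.length) = ⊤ ∧ StrictMono p ∧
      (∀ i : Fin z.length,
        (0 < z.get i ∧
          a.toJordanDecomposition.posPart (realIoc (p i.castSucc) (p i.succ))
            = ENNReal.ofReal (z.get i) ∧
          a.toJordanDecomposition.negPart (realIoc (p i.castSucc) (p i.succ)) = 0) ∨
        (z.get i < 0 ∧
          a.toJordanDecomposition.posPart (realIoc (p i.castSucc) (p i.succ)) = 0 ∧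
          a.toJordanDecomposition.negPart (realIoc (p i.castSucc) (p i.succ))
            = ENNReal.ofReal (-z.get i))) ∧
      ∀ i j : Fin z.length, (j : ℕ) = i + 1 → z.get i * z.get j < 0 := by
  obtain ⟨p, piece, h0, hlast, hp, hsum, -, hpiece, halt, hval⟩ := hz
  set I : Fin z.length → Set ℝ := fun i => realIoc (p i.castSucc) (p i.succ) with hI
  have hIm : ∀ i, MeasurableSet (I i) := fun i => measurableSet_realIoc _ _
  have hrestr : ∀ i, a (I i) = piece i univ := by
    intro i
    have hs : a (I i) = ∑ k, piece k (I i) := by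
      conv_lhs => rw [hsum]
      simp
    rw [hs, Finset.sum_eq_single i]
    · rcases hpiece i with h | h <;> rw [h] <;>
        simp [measureReal_def, hI, measurableSet_realIoc]
    · intro k _ hk
      have hd : I i ∩ I k = ∅ := (disjoint_realIoc hp hk.symm).inter_eq
      rcases hpiece k with h | h <;> rw [h] <;>
        simp [Measure.toSignedMeasure_apply_measurable (hIm i), measureReal_def,
          Measure.restrict_apply (hIm i)] <;> simp [hI] at hd <;> simp [hI, hd]
    · simp
  have hjordan : ∀ i, a (I i) = (a.toJordanDecomposition.posPart (I i)).toReal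
      - (a.toJordanDecomposition.negPart (I i)).toReal := fun i =>
    SignedMeasure.apply_eq_posPart_real_sub_negPart_real a (hIm i)
  have hzalt : ∀ i j : Fin z.length, (j : ℕ) = i + 1 → z.get i * z.get j < 0 := by
    intro i j hij
    rw [hval, hval, hrestr, hrestr]
    exact halt i j hij
  have hsign : ∀ i, (0 ≤ z.get i ∧ a.toJordanDecomposition.posPart (I i)
        = ENNReal.ofReal (z.get i) ∧ a.toJordanDecomposition.negPart (I i) = 0) ∨
      (z.get i ≤ 0 ∧ a.toJordanDecomposition.posPart (I i) = 0 ∧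
        a.toJordanDecomposition.negPart (I i) = ENNReal.ofReal (-z.get i)) := by
    intro i
    have hv : z.get i = a (I i) := hval i
    have e1 := hrestr i
    have e2 := hjordan i
    rcases hpiece i with h | h
    · left
      have e3 : piece i univ = (a.toJordanDecomposition.posPart (I i)).toReal := by
        rw [h]; simp [measureReal_def, hI]
      have e4 : (a.toJordanDecomposition.negPart (I i)).toReal = 0 := by linarith
      rw [hv, e1, e3, ENNReal.ofReal_toReal (measure_ne_top _ _)]
      exact ⟨ENNReal.toReal_nonneg, rfl,
        ((ENNReal.toReal_eq_zero_iff _).1 e4).resolve_right (measure_ne_top _ _)⟩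
    · right
      have e3 : piece i univ = -(a.toJordanDecomposition.negPart (I i)).toReal := by
        rw [h]; simp [measureReal_def, hI]
      have e4 : (a.toJordanDecomposition.posPart (I i)).toReal = 0 := by linarith
      rw [hv, e1, e3, neg_neg, ENNReal.ofReal_toReal (measure_ne_top _ _)]
      exact ⟨neg_nonpos.2 ENNReal.toReal_nonneg,
        ((ENNReal.toReal_eq_zero_iff _).1 e4).resolve_right (measure_ne_top _ _), rfl⟩
  have hne : ∀ i, z.get i ≠ 0 := by
    intro i hi0
    by_cases hnext : (i : ℕ) + 1 < z.length
    · have := hzalt i ⟨i + 1, hnext⟩ rfl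
      rw [hi0, zero_mul] at this
      exact this.false
    by_cases hprev : (i : ℕ) = 0
    · -- A single interval: `a` has constant sign, so zero total charge forces `a = 0`.
      have huniv : I i = univ := by
        have hz1 : z.length = 1 := by omega
        rw [← iUnion_realIoc h0 hlast]
        refine Subset.antisymm (subset_iUnion I i) (iUnion_subset fun k => ?_)
        have : k = i := Fin.ext (by omega)
        rw [this]
      apply ha
      rcases hsign i with h | h <;>
        · rw [hi0, huniv] at h
          simp only [SignedMeasure.totalVariation, Measure.add_apply, h.2.1, h.2.2]
          simp
    · have := hzalt ⟨i - 1, by omega⟩ i (by simp; omega)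
      rw [hi0, mul_zero] at this
      exact this.false
  refine ⟨p, h0, hlast, hp, fun i => ?_, hzalt⟩
  exact (hsign i).imp (fun h => ⟨lt_of_le_of_ne h.1 (hne i).symm, h.2⟩)
    (fun h => ⟨lt_of_le_of_ne h.1 (hne i), h.2⟩)

/-- The zero measure has only the signature `(0)`: adjacent pieces must be nonzero, and at least
one interval is needed to cover the line. -/
theorem HasSignature.eq_singleton_zero {a : SignedMeasure ℝ} {z : List ℝ}
    (hz : HasSignature a z) (ha : a.totalVariation univ = 0) : z = [0] := by
  obtain ⟨p, piece, h0, hlast, hp, hsum, -, hpiece, halt, hval⟩ := hz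
  simp only [SignedMeasure.totalVariation, Measure.add_apply, add_eq_zero,
    Measure.measure_univ_eq_zero] at ha
  have hpiece0 : ∀ i, piece i = 0 := by
    intro i
    rcases hpiece i with h | h <;> rw [h] <;> simp [ha.1, ha.2]
  have ha0 : a = 0 := by rw [hsum]; simp [hpiece0]
  have hlen : z.length = 1 := by
    by_contra hne
    rcases Nat.lt_or_gt_of_ne hne with h | h
    · have : Fin.last z.length = 0 := Fin.ext (by rw [Fin.val_last, Fin.val_zero]; omega)
      rw [this, h0] at hlast
      exact bot_ne_top hlast
    · have := halt ⟨0, by omega⟩ ⟨1, h⟩ rfl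
      simp [hpiece0] at this
  obtain ⟨r, rfl⟩ := List.length_eq_one_iff.1 hlen
  have := hval ⟨0, by simp⟩
  simpa [ha0] using this

/-! ### Monotone transport preserves signatures -/

theorem measure_le_of_cover {X ι : Type*} [MeasurableSpace X] [Countable ι] {μ : Measure X}
    {s : Set X} {t : ι → Set X} (ht : ⋃ i, t i = univ) (j : ι)
    (h0 : ∀ i, i ≠ j → μ (s ∩ t i) = 0) : μ s ≤ μ (s ∩ t j) := by
  refine (measure_mono ?_).trans ((measure_union_le (s ∩ t j)
    (⋃ (i) (_ : i ≠ j), s ∩ t i)).trans_eq ?_)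
  · intro x hx
    obtain ⟨i, hi⟩ := mem_iUnion.1 (ht ▸ mem_univ x : x ∈ ⋃ i, t i)
    by_cases hij : i = j
    · exact Or.inl ⟨hx, hij ▸ hi⟩
    · exact Or.inr (mem_iUnion₂.2 ⟨i, hij, hx, hi⟩)
  · rw [measure_iUnion_null fun i => measure_iUnion_null (h0 i), add_zero]

/-- The contrapositive form of the theorem: a kernel that is optimal on the bounded density class
and sends `a` to `b` forces the signatures to agree. -/
theorem signature_eq_of_kernel
    {h : ℝ → ℝ} (h_nonneg : ∀ t, 0 ≤ h t) (h_convex : StrictConvexOn ℝ univ h)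
    {cX cY : ℝ → ℝ} (h_bound : ∀ x y, h (y - x) ≤ cX x + cY y) {a b : SignedMeasure ℝ}
    (h_mass : a.totalVariation univ = b.totalVariation univ)
    (ha_moment : Integrable cX a.totalVariation) (hb_moment : Integrable cY b.totalVariation)
    {z w : List ℝ} (hz : HasSignature a z) (hw : HasSignature b w)
    {K : Kernel ℝ ℝ} [IsMarkovKernel K]
    (hopt : IsOptimalTransportKernelOn (fun x y => h (y - x))
      (boundedDensityClass cX a.totalVariation) K)
    (hK : signedImage a K = b) : z = w := by
  by_cases ha : a.totalVariation univ = 0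
  · rw [hz.eq_singleton_zero ha, hw.eq_singleton_zero (h_mass ▸ ha)]
  obtain ⟨p, p0, plast, hp, hpz, hzalt⟩ := hz.exists_intervals ha
  obtain ⟨q, q0, qlast, hq, hqw, hwalt⟩ := hw.exists_intervals (h_mass ▸ ha)
  obtain ⟨hKpos, hKneg⟩ := image_parts_of_signedImage_eq hK h_mass
  set ap := a.toJordanDecomposition.posPart
  set an := a.toJordanDecomposition.negPart
  set bp := b.toJordanDecomposition.posPart
  set bn := b.toJordanDecomposition.negPart
  have hta : a.totalVariation = ap + an := rfl
  have htb : b.totalVariation = bp + bn := rfl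
  have hKtv : K ∘ₘ (ap + an) = bp + bn := by rw [Measure.comp_add, hKpos, hKneg]
  rw [hta] at ha ha_moment hopt
  rw [htb] at hb_moment
  set I : Fin z.length → Set ℝ := fun i => realIoc (p i.castSucc) (p i.succ) with hI
  set J : Fin w.length → Set ℝ := fun j => realIoc (q j.castSucc) (q j.succ) with hJ
  have hIm : ∀ i, MeasurableSet (I i) := fun i => measurableSet_realIoc _ _
  have hJm : ∀ j, MeasurableSet (J j) := fun j => measurableSet_realIoc _ _
  have hIu : ⋃ i, I i = univ := iUnion_realIoc p0 plast
  have hJu : ⋃ j, J j = univ := iUnion_realIoc q0 qlast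
  set Γ := (ap + an) ⊗ₘ K with hΓ
  have hΓadd : Γ = ap ⊗ₘ K + an ⊗ₘ K := Measure.compProd_add_left _ _ _
  have hΓI : ∀ i, Γ (Prod.fst ⁻¹' I i) = (ap + an) (I i) := fun i => by
    rw [← Measure.fst_apply (hIm i), Measure.fst_compProd]
  have hΓJ : ∀ j, Γ (Prod.snd ⁻¹' J j) = (bp + bn) (J j) := fun j => by
    rw [← Measure.snd_apply (hJm j), Measure.snd_compProd, hKtv]
  have hIpos : ∀ i, (ap + an) (I i) = ENNReal.ofReal |z.get i| := by
    intro i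
    rcases hpz i with ⟨h1, h2, h3⟩ | ⟨h1, h2, h3⟩
    · rw [Measure.add_apply, h2, h3, abs_of_pos h1, add_zero]
    · rw [Measure.add_apply, h2, h3, abs_of_neg h1, zero_add]
  have hJpos : ∀ j, (bp + bn) (J j) = ENNReal.ofReal |w.get j| := by
    intro j
    rcases hqw j with ⟨h1, h2, h3⟩ | ⟨h1, h2, h3⟩
    · rw [Measure.add_apply, h2, h3, abs_of_pos h1, add_zero]
    · rw [Measure.add_apply, h2, h3, abs_of_neg h1, zero_add]
  have hzne : ∀ i, z.get i ≠ 0 := fun i => (hpz i).elim (fun h => h.1.ne') (fun h => h.1.ne)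
  have hwne : ∀ j, w.get j ≠ 0 := fun j => (hqw j).elim (fun h => h.1.ne') (fun h => h.1.ne)
  -- The normalized total variation is an admissible input of finite cost, so its plan is optimal.
  have hmem := inv_smul_mem_boundedDensityClass ha ha_moment
  set M := (ap + an) univ with hM
  have hMtop : M⁻¹ ≠ ∞ := ENNReal.inv_ne_top.2 ha
  have hM0 : M⁻¹ ≠ 0 := ENNReal.inv_ne_zero.2 (measure_ne_top _ _)
  have : IsProbabilityMeasure (M⁻¹ • (ap + an)) := hmem.1
  have hcost : transportCost (fun x y => h (y - x)) ((M⁻¹ • (ap + an)) ⊗ₘ K) < ∞ := by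
    refine transportCost_compProd_lt_top h_bound (ha_moment.smul_measure hMtop) ?_
    rw [Measure.comp_smul, hKtv]
    exact hb_moment.smul_measure hMtop
  have hcoup := hopt _ hmem hmem.1 hcost
  have hcont : Continuous h := by
    simpa [continuousOn_univ] using h_convex.convexOn.continuousOn isOpen_univ
  have hmeas : Measurable fun r : ℝ × ℝ => h (r.2 - r.1) := by fun_prop
  have hR_mono : ∀ i i' j j', i < i' → Γ (I i ×ˢ J j) ≠ 0 → Γ (I i' ×ˢ J j') ≠ 0 → j ≤ j' := by
    intro i i' j j' hii h1 h2
    by_contra! hjj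
    have := hcoup.measure_eq_zero_of_crossing hmeas (fun _ _ => h_nonneg _) hcost
      ((hIm i).prod (hJm j)) ((hIm i').prod (hJm j'))
      (Disjoint.set_prod_left (disjoint_realIoc hp hii.ne) _ _)
      (fun r hr s hs => StrictConvexOn.crossing_lt h_convex (realIoc_lt hp hii hr.1 hs.1)
        (realIoc_lt hq hjj hs.2 hr.2))
    rw [Measure.compProd_smul_left, ← hΓ] at this
    simp only [Measure.smul_apply, smul_eq_mul, mul_eq_zero, hM0, h1, h2, or_self] at this
  have hR_sign : ∀ i j, Γ (I i ×ˢ J j) ≠ 0 → (0 < z.get i ↔ 0 < w.get j) := by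
    intro i j hij
    rw [hΓadd, Measure.add_apply] at hij
    have l1 := compProd_prod_le_left ap K (J j) (hIm i)
    have l2 := compProd_prod_le_left an K (J j) (hIm i)
    have r1 := compProd_prod_le_right ap K (I i) (hJm j)
    have r2 := compProd_prod_le_right an K (I i) (hJm j)
    rw [hKpos] at r1
    rw [hKneg] at r2
    rcases hpz i with ⟨s1, s2, s3⟩ | ⟨s1, s2, s3⟩ <;>
      rcases hqw j with ⟨t1, t2, t3⟩ | ⟨t1, t2, t3⟩
    · exact ⟨fun _ => t1, fun _ => s1⟩
    -- Opposite signs: `a⁺` is sent to `b⁺` and `a⁻` to `b⁻`, so neither part charges `Iᵢ × Jⱼ`.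
    · exact absurd (by rw [le_zero_iff.1 (r1.trans_eq t2), le_zero_iff.1 (l2.trans_eq s3),
        add_zero]) hij
    · exact absurd (by rw [le_zero_iff.1 (l1.trans_eq s2), le_zero_iff.1 (r2.trans_eq t3),
        add_zero]) hij
    · exact ⟨fun h => absurd h s1.not_gt, fun h => absurd h t1.not_gt⟩
  have hR_left : ∀ i, ∃ j, Γ (I i ×ˢ J j) ≠ 0 := by
    intro i
    by_contra! hall
    have h0 : Γ (Prod.fst ⁻¹' I i) = 0 := by
      refine measure_mono_null ?_ (measure_iUnion_null hall)
      rw [← prod_iUnion, hJu]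
      exact fun r hr => ⟨hr, mem_univ _⟩
    rw [hΓI, hIpos, ENNReal.ofReal_eq_zero] at h0
    exact hzne i (abs_nonpos_iff.1 h0)
  have hR_right : ∀ j, ∃ i, Γ (I i ×ˢ J j) ≠ 0 := by
    intro j
    by_contra! hall
    have h0 : Γ (Prod.snd ⁻¹' J j) = 0 := by
      refine measure_mono_null ?_ (measure_iUnion_null hall)
      rw [← iUnion_prod_const, hIu]
      exact fun r hr => ⟨mem_univ _, hr⟩
    rw [hΓJ, hJpos, ENNReal.ofReal_eq_zero] at h0
    exact hwne j (abs_nonpos_iff.1 h0)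
  have halt : ∀ u v : ℝ, u * v < 0 → ¬ (0 < u ↔ 0 < v) := by
    intro u v huv hiff
    rcases mul_neg_iff.1 huv with ⟨h1, h2⟩ | ⟨h1, h2⟩
    · exact absurd (hiff.1 h1) h2.not_gt
    · exact absurd (hiff.2 h2) h1.not_gt
  have hR_eq : ∀ i j, Γ (I i ×ˢ J j) ≠ 0 → (i : ℕ) = j := by
    intro i j hij
    refine le_antisymm ?_ ?_
    · exact index_le_of_alternating hR_left hR_mono hR_sign
        (fun i i' hii => halt _ _ (hzalt i i' hii)) i j hij
    · refine index_le_of_alternating (R := fun j i => Γ (I i ×ˢ J j) ≠ 0) hR_right ?_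
        (fun j i hij => (hR_sign i j hij).symm)
        (fun j j' hjj => halt _ _ (hwalt j j' hjj)) j i hij
      intro j j' i i' hjj h1 h2
      by_contra! hii
      exact absurd (hR_mono i' i j' j hii h2 h1) hjj.not_ge
  have hlen : z.length = w.length := by
    refine le_antisymm (not_lt.1 fun hlt => ?_) (not_lt.1 fun hlt => ?_)
    · obtain ⟨j, hj⟩ := hR_left ⟨w.length, hlt⟩
      have := hR_eq _ _ hj
      simp only at this
      omega
    · obtain ⟨i, hi⟩ := hR_right ⟨z.length, hlt⟩
      have := hR_eq _ _ hi
      simp only at this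
      omega
  refine List.ext_get hlen fun k hk hk' => ?_
  have hprod : ∀ i j, Prod.fst ⁻¹' I i ∩ Prod.snd ⁻¹' J j = I i ×ˢ J j := fun i j => rfl
  have hle1 : (ap + an) (I ⟨k, hk⟩) ≤ Γ (I ⟨k, hk⟩ ×ˢ J ⟨k, hk'⟩) := by
    rw [← hΓI]
    refine measure_le_of_cover (t := fun j => Prod.snd ⁻¹' J j) (by
      rw [← preimage_iUnion, hJu, preimage_univ]) ⟨k, hk'⟩ fun j hj => ?_
    by_contra hne
    exact hj (Fin.ext (hR_eq _ _ hne).symm)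
  have hle2 : (bp + bn) (J ⟨k, hk'⟩) ≤ Γ (I ⟨k, hk⟩ ×ˢ J ⟨k, hk'⟩) := by
    rw [← hΓJ, ← hprod, inter_comm]
    refine measure_le_of_cover (t := fun i => Prod.fst ⁻¹' I i) (by
      rw [← preimage_iUnion, hIu, preimage_univ]) ⟨k, hk⟩ fun i hi => ?_
    rw [inter_comm]
    by_contra hne
    exact hi (Fin.ext (hR_eq _ _ hne))
  have habs : |z.get ⟨k, hk⟩| = |w.get ⟨k, hk'⟩| := by
    have e1 := le_antisymm hle1
      ((measure_mono fun r hr => hr.1).trans_eq (hΓI ⟨k, hk⟩))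
    have e2 := le_antisymm hle2
      ((measure_mono fun r hr => hr.2).trans_eq (hΓJ ⟨k, hk'⟩))
    have e := e1.trans e2.symm
    rw [hIpos, hJpos] at e
    exact (ENNReal.ofReal_eq_ofReal_iff (abs_nonneg _) (abs_nonneg _)).1 e
  have hsgn : 0 < z.get ⟨k, hk⟩ ↔ 0 < w.get ⟨k, hk'⟩ := by
    obtain ⟨j, hj⟩ := hR_left ⟨k, hk⟩
    have : j = ⟨k, hk'⟩ := Fin.ext (hR_eq _ _ hj).symm
    exact this ▸ hR_sign _ _ hj
  rcases abs_eq_abs.1 habs with h1 | h1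
  · exact h1
  · rcases lt_or_gt_of_ne (hwne ⟨k, hk'⟩) with h2 | h2
    · have := hsgn.1 (by linarith)
      linarith
    · have := hsgn.2 h2
      linarith

end KernelOT

theorem theorem5p5
    (h : ℝ → ℝ) (h_nonneg : ∀ t, 0 ≤ h t) (h_convex : StrictConvexOn ℝ Set.univ h)
    (cX cY : ℝ → ℝ) (h_bound : ∀ x y, h (y - x) ≤ cX x + cY y)
    (a b : SignedMeasure ℝ)
    (h_mass : a.totalVariation Set.univ = b.totalVariation Set.univ)
    (h_integral : a Set.univ = b Set.univ)
    (ha_moment : Integrable cX a.totalVariation)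
    (hb_moment : Integrable cY b.totalVariation)
    (z w : List ℝ) (hz : KernelOT.HasSignature a z) (hw : KernelOT.HasSignature b w)
    (hzw : z ≠ w) :
    (¬ ∃ (K : Kernel ℝ ℝ) (_ : IsMarkovKernel K),
      KernelOT.IsOptimalTransportKernel (fun x y => h (y - x)) K ∧
        KernelOT.signedImage a K = b) ∧
    (¬ ∃ (K : Kernel ℝ ℝ) (_ : IsMarkovKernel K),
      KernelOT.IsOptimalTransportKernelOn (fun x y => h (y - x))
          (KernelOT.boundedDensityClass cX a.totalVariation) K ∧
        KernelOT.signedImage a K = b) := by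
  refine ⟨?_, ?_⟩
  · rintro ⟨K, _, hopt, hK⟩
    exact hzw (KernelOT.signature_eq_of_kernel h_nonneg h_convex h_bound h_mass ha_moment
      hb_moment hz hw (fun μ _ => hopt μ (Set.mem_univ μ)) hK)
  · rintro ⟨K, _, hopt, hK⟩
    exact hzw (KernelOT.signature_eq_of_kernel h_nonneg h_convex h_bound h_mass ha_moment
      hb_moment hz hw hopt hK)
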